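/- **Setting.** All labeled probabilistic transition systems (LPTSes) $L=\langle S_L,s^0_L,\alpha_L,\tau_L\rangle$ have a finite state set $S_L$ with start state $s^0_L\in S_L$, a finite alphabet $\alpha_L$, and a finite transition relation $\tau_L\subseteq S_L\times\alpha_L\times\mathrm{Dist}(S_L)$, where $\mathrm{Dist}(S)$ is the set of distributions on $S$ with rational probabilities; write $s\xrightarrow{a}\mu$ for $(s,a,\mu)\in\tau_L$. Let $\delta_s$ be the Dirac distribution on $s$ and $(\mu_1\otimes\mu_2)(s_1,s_2)=\mu_1(s_1)\mu_2(s_2)$. The parallel composition $L_1\parallel L_2$ has states $S_1\times S_2$, start state $(s^0_1,s^0_2)$, alphabet $\alpha_1\cup\alpha_2$ and the transitions $(s_1,s_2)\xrightarrow{a}\mu_1\otimes\mu_2$ if $s_1\xrightarrow{a}\mu_1$, $s_2\xrightarrow{a}\mu_2$; $(s_1,s_2)\xrightarrow{a}\mu_1\otimes\delta_{s_2}$ if $s_1\xrightarrow{a}\mu_1$, $a\notin\alpha_2$; and $(s_1,s_2)\xrightarrow{a}\delta_{s_1}\otimes\mu_2$ if $a\notin\alpha_1$, $s_2\xrightarrow{a}\mu_2$.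 For $R\subseteq S\times S'$ write $\mu\sqsubseteq_R\mu'$ if there is $w:S\times S'\to\mathbb{Q}\cap[0,1]$ with marginals $\mu$ and $\mu'$ such that $w(s,s')>0$ implies $s\,R\,s'$. $R$ is a strong simulation if $s\,R\,s'$ and $s\xrightarrow{a}\mu$ imply $s'\xrightarrow{a}\mu'$ with $\mu\sqsubseteq_R\mu'$ for some $\mu'$; $L\preceq L'$ means that some strong simulation relates $s^0_L$ to $s^0_{L'}$. When $L\preceq P$ is checked against a specification $P$, $P$ is first completed by Dirac self-loops at all its states on all actions in $\alpha_L\setminus\alpha_P$. A counterexample to $L\preceq P$ is an LPTS $C$ with $C\preceq L$ and $C\not\preceq P$ (with $P$ completed for $L$). A tree is an LPTS whose states are all reachable from the start state, whose start state is in the support of no transition, and each of whose other states is in the support of exactly one transition. An execution mapping from $C$ to $L$ is a map $M:S_C\to S_L$ with $M(s^0_C)=s^0_L$ such that for each $c\xrightarrow{a}\mu$ there is $M(c)\xrightarrow{a}\nu$ with $M$ injective on $\mathrm{supp}(\mu)$ and $\mu(c')=\nu(M(c'))$ for $c'\in\mathrm{supp}(\mu)$. For a partition $\Pi$ of $S_L$,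 $[s]_\Pi$ is the class of $s$ and the quotient $L/\Pi$ has states $\Pi$, start state $[s^0_L]_\Pi$, alphabet $\alpha_L$ and the transitions $[s]_\Pi\xrightarrow{a}\bar\mu$ for $s\xrightarrow{a}\mu$, where $\bar\mu(c)=\sum_{t\in c}\mu(t)$. **The algorithm AGAR** (input $L_1,L_2,P$). Start with the coarsest partition $\Pi$ of $S_2$ and repeat, with $A=L_2/\Pi$: 1. If $L_1\parallel A\preceq P$, return "$L_1\parallel L_2\preceq P$ holds". 2. Otherwise obtain any tree counterexample $C$ to $L_1\parallel A\preceq P$ with an execution mapping to $L_1\parallel A$, and form its projection $C{\restriction}_A$ onto $A$: merge the source of every transition with label outside $\alpha_2$ with all its successors, merge the successors of one transition that are mapped to the same state of $A$, and keep the transitions with labels in $\alpha_2$, with the image distributions. Let $M$ be the induced mapping from $C{\restriction}_A$ to $A$. 3. Let $R=\{(c,s): M(c)=[s]_\Pi\}$ and go through the transitions $c\xrightarrow{a}\mu$ of $C{\restriction}_A$ in any bottom-up order (each transition once, after all transitions of the states in $\mathrm{supp}(\mu)$). For each, let $R_{\rm old}=R$ and remove from $R$ all $(c,s)$ such that no $s\xrightarrow{a}\nu$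 in $L_2$ satisfies $\mu\sqsubseteq_{R_{\rm old}}\nu$. (i) If now $R(c)=\emptyset$, split the class $M(c)$ into $R_{\rm old}(c)$ and the rest and, for every $c'\in\mathrm{supp}(\mu)$, split the class $M(c')$ into $R_{\rm old}(c')$ and the rest, unless $M(c')=M(c)$ and this class has already been split. (ii) If $R(c)\neq\emptyset$, $M(c)=[s^0_2]_\Pi$ and $s^0_2\in R_{\rm old}(c)\setminus R(c)$, split the class $M(c)$ into $R_{\rm old}(c)\setminus R(c)$ and the rest. In both cases $C$ is spurious, and the loop continues with the partition so obtained (one refinement). 4. If neither case occurs for any transition, return $C$. **Theorem (Correctness and Termination of AGAR).** Let $L_1,L_2,P$ be LPTSes. For all choices of counterexamples and traversal orders, every run of AGAR terminates after at most $|S_2|-1$ refinements: no run is infinite or makes more refinements, whenever $L_1\parallel A\not\preceq P$ in a run a tree counterexample as in step 2 exists, and for each such counterexample a bottom-up order as in step 3 exists. Moreover, $L_1\parallel L_2\not\preceq P$ if and only if the run returns a real counterexample, i.e. a counterexample $C$ to $L_1\parallel L_2\preceq P$; and $L_1\parallel L_2\preceq P$ if and only if the run returns "$L_1\parallel L_2\preceq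 P$ holds". -/

import Mathlib

universe u v

/-- A discrete probability distribution with rational probabilities on a finite set `S`. -/
@[ext]
structure ProbDist (S : Type*) [Fintype S] where
  prob : S → ℚ
  nonneg : ∀ s, 0 ≤ prob s
  sum_eq_one : ∑ s, prob s = 1

namespace ProbDist

/-- The support of a distribution. -/
def supp {S : Type*} [Fintype S] (μ : ProbDist S) : Set S := {s | 0 < μ.prob s}

open Classical in
/-- The Dirac distribution on `s`. -/
noncomputable def dirac {S : Type*} [Fintype S] (s : S) : ProbDist S where
  prob t := if t = s then 1 else 0
  nonneg t := by split_ifs <;> norm_num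
  sum_eq_one := by simp

/-- The product of two distributions. -/
def prod {S T : Type*} [Fintype S] [Fintype T] (μ : ProbDist S) (ν : ProbDist T) :
    ProbDist (S × T) where
  prob p := μ.prob p.1 * ν.prob p.2
  nonneg p := mul_nonneg (μ.nonneg _) (ν.nonneg _)
  sum_eq_one := by
    rw [Fintype.sum_prod_type, ← Fintype.sum_mul_sum, μ.sum_eq_one, ν.sum_eq_one, one_mul]

open Classical in
/-- The image distribution: the probability of `t` is the total probability of its fibre. -/
noncomputable def map {S T : Type*} [Fintype S] [Fintype T] (f : S → T) (μ : ProbDist S) :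
    ProbDist T where
  prob t := ∑ s with f s = t, μ.prob s
  nonneg t := Finset.sum_nonneg fun s _ => μ.nonneg s
  sum_eq_one := by
    rw [← μ.sum_eq_one]
    exact Finset.sum_fiberwise Finset.univ f μ.prob

/-- `μ ⊑_R ν`: there is a rational weight function with marginals `μ` and `ν` that is
concentrated on `R`. -/
def Below {S T : Type*} [Fintype S] [Fintype T] (R : S → T → Prop) (μ : ProbDist S)
    (ν : ProbDist T) : Prop :=
  ∃ w : S → T → ℚ, (∀ s t, 0 ≤ w s t ∧ w s t ≤ 1) ∧
    (∀ s, μ.prob s = ∑ t, w s t) ∧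
    (∀ t, ν.prob t = ∑ s, w s t) ∧
    (∀ s t, 0 < w s t → R s t)

end ProbDist

/-- A labeled probabilistic transition system with finitely many states, a finite alphabet and
finitely many transitions. All action names are drawn from a common type `Act`. -/
structure LPTS (Act : Type u) where
  State : Type v
  [fintypeState : Fintype State]
  start : State
  alphabet : Set Act
  alphabet_finite : alphabet.Finite
  trans : Set (State × Act × ProbDist State)
  trans_finite : trans.Finite
  label_mem : ∀ t ∈ trans, t.2.1 ∈ alphabet

attribute [instance] LPTS.fintypeState

namespace LPTS

variable {Act : Type u}

/-- Parallel composition: synchronisation on common actions, interleaving on the others. -/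
noncomputable def comp (L₁ L₂ : LPTS.{u, v} Act) : LPTS.{u, v} Act where
  State := L₁.State × L₂.State
  start := (L₁.start, L₂.start)
  alphabet := L₁.alphabet ∪ L₂.alphabet
  alphabet_finite := L₁.alphabet_finite.union L₂.alphabet_finite
  trans := {t |
    (∃ s₁ s₂ a μ₁ μ₂, (s₁, a, μ₁) ∈ L₁.trans ∧ (s₂, a, μ₂) ∈ L₂.trans ∧
      t = ((s₁, s₂), a, μ₁.prod μ₂)) ∨
    (∃ s₁ s₂ a μ₁, (s₁, a, μ₁) ∈ L₁.trans ∧ a ∉ L₂.alphabet ∧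
      t = ((s₁, s₂), a, μ₁.prod (ProbDist.dirac s₂))) ∨
    (∃ s₁ s₂ a μ₂, a ∉ L₁.alphabet ∧ (s₂, a, μ₂) ∈ L₂.trans ∧
      t = ((s₁, s₂), a, (ProbDist.dirac s₁).prod μ₂))}
  trans_finite := by
    refine Set.Finite.subset (s := (fun p : (L₁.State × Act × ProbDist L₁.State) ×
        (L₂.State × Act × ProbDist L₂.State) =>
          ((p.1.1, p.2.1), p.1.2.1, p.1.2.2.prod p.2.2.2)) '' (L₁.trans ×ˢ L₂.trans) ∪
      ((fun p : (L₁.State × Act × ProbDist L₁.State) × L₂.State =>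
          ((p.1.1, p.2), p.1.2.1, p.1.2.2.prod (ProbDist.dirac p.2))) ''
            (L₁.trans ×ˢ Set.univ) ∪
       (fun p : L₁.State × (L₂.State × Act × ProbDist L₂.State) =>
          ((p.1, p.2.1), p.2.2.1, (ProbDist.dirac p.1).prod p.2.2.2)) ''
            (Set.univ ×ˢ L₂.trans))) ?_ ?_
    · exact ((L₁.trans_finite.prod L₂.trans_finite).image _).union
        (((L₁.trans_finite.prod Set.finite_univ).image _).union
          ((Set.finite_univ.prod L₂.trans_finite).image _))
    · rintro t (⟨s₁, s₂, a, μ₁, μ₂, h₁, h₂, rfl⟩ | ⟨s₁, s₂, a, μ₁, h₁, -, rfl⟩ |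
        ⟨s₁, s₂, a, μ₂, -, h₂, rfl⟩)
      · exact Or.inl ⟨((s₁, a, μ₁), (s₂, a, μ₂)), ⟨h₁, h₂⟩, rfl⟩
      · exact Or.inr (Or.inl ⟨((s₁, a, μ₁), s₂), ⟨h₁, trivial⟩, rfl⟩)
      · exact Or.inr (Or.inr ⟨(s₁, (s₂, a, μ₂)), ⟨trivial, h₂⟩, rfl⟩)
  label_mem := by
    rintro t (⟨s₁, s₂, a, μ₁, μ₂, h₁, h₂, rfl⟩ | ⟨s₁, s₂, a, μ₁, h₁, -, rfl⟩ |
        ⟨s₁, s₂, a, μ₂, -, h₂, rfl⟩)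
    · exact Or.inl (L₁.label_mem _ h₁)
    · exact Or.inl (L₁.label_mem _ h₁)
    · exact Or.inr (L₂.label_mem _ h₂)

/-- `R` is a strong simulation between the states of `L₁` and those of `L₂`. -/
def IsStrongSim (L₁ L₂ : LPTS.{u, v} Act) (R : L₁.State → L₂.State → Prop) : Prop :=
  ∀ s₁ s₂, R s₁ s₂ → ∀ a μ₁, (s₁, a, μ₁) ∈ L₁.trans →
    ∃ μ₂, (s₂, a, μ₂) ∈ L₂.trans ∧ ProbDist.Below R μ₁ μ₂

/-- `L₁ ⪯ L₂`: the start state of `L₂` strongly simulates the start state of `L₁`. -/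
def Sim (L₁ L₂ : LPTS.{u, v} Act) : Prop :=
  ∃ R, IsStrongSim L₁ L₂ R ∧ R L₁.start L₂.start

/-- The completion of a specification `P` for a system `L`: every state of `P` gets a Dirac
self-loop on every action of `L` that is not in the alphabet of `P`. -/
noncomputable def completeFor (P L : LPTS.{u, v} Act) : LPTS.{u, v} Act where
  State := P.State
  start := P.start
  alphabet := P.alphabet ∪ L.alphabet
  alphabet_finite := P.alphabet_finite.union L.alphabet_finite
  trans := P.trans ∪ {t | ∃ s, ∃ a ∈ L.alphabet \ P.alphabet, t = (s, a, ProbDist.dirac s)}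
  trans_finite := by
    refine P.trans_finite.union (Set.Finite.subset
      (s := (fun p : P.State × Act => (p.1, p.2, ProbDist.dirac p.1)) ''
        (Set.univ ×ˢ L.alphabet)) ?_ ?_)
    · exact (Set.finite_univ.prod L.alphabet_finite).image _
    · rintro t ⟨s, a, ha, rfl⟩
      exact ⟨(s, a), ⟨trivial, ha.1⟩, rfl⟩
  label_mem := by
    rintro t (h | ⟨s, a, ha, rfl⟩)
    · exact Or.inl (P.label_mem _ h)
    · exact Or.inr ha.1

/-- `L` conforms to the specification `P`, i.e. `L ⪯ P` with `P` completed for `L`. -/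
def Conforms (L P : LPTS.{u, v} Act) : Prop := L.Sim (P.completeFor L)

/-- `C` is a (real) counterexample to the conformance `L ⪯ P`. -/
def IsCounterexample (C L P : LPTS.{u, v} Act) : Prop :=
  C.Sim L ∧ ¬ C.Sim (P.completeFor L)

/-- One-step reachability. -/
def Succ (L : LPTS.{u, v} Act) (s t : L.State) : Prop :=
  ∃ a μ, (s, a, μ) ∈ L.trans ∧ t ∈ μ.supp

/-- Stochastic trees: all states are reachable from the start state, which is in the support of
no transition, and every other state is in the support of exactly one transition. -/
structure IsTree (C : LPTS.{u, v} Act) : Prop where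
  start_notMem : ∀ t ∈ C.trans, C.start ∉ t.2.2.supp
  existsUnique : ∀ c, c ≠ C.start → ∃! t, t ∈ C.trans ∧ c ∈ t.2.2.supp
  reachable : ∀ c, Relation.ReflTransGen C.Succ C.start c

/-- `M` is an execution mapping from `C` to `L`. -/
structure IsExecutionMapping (C L : LPTS.{u, v} Act) (M : C.State → L.State) : Prop where
  map_start : M C.start = L.start
  map_trans : ∀ c a μ, (c, a, μ) ∈ C.trans → ∃ ν, (M c, a, ν) ∈ L.trans ∧
    Set.InjOn M μ.supp ∧ ∀ c' ∈ μ.supp, μ.prob c' = ν.prob (M c')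

/-- The quotient `L/q` of `L` by the partition of its states into the classes of `q`. -/
noncomputable def quot (L : LPTS.{u, v} Act) (q : Setoid L.State) : LPTS.{u, v} Act where
  State := Quotient q
  fintypeState := Fintype.ofFinite _
  start := Quotient.mk q L.start
  alphabet := L.alphabet
  alphabet_finite := L.alphabet_finite
  trans :=
    letI : Fintype (Quotient q) := Fintype.ofFinite _
    {t | ∃ s a μ, (s, a, μ) ∈ L.trans ∧
      t = (Quotient.mk q s, a, ProbDist.map (Quotient.mk q) μ)}
  trans_finite := by
    let : Fintype (Quotient q) := Fintype.ofFinite _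
    refine (L.trans_finite.image fun t =>
      (Quotient.mk q t.1, t.2.1, ProbDist.map (Quotient.mk q) t.2.2)).subset ?_
    rintro t ⟨s, a, μ, h, rfl⟩
    exact ⟨_, h, rfl⟩
  label_mem := by
    rintro t ⟨s, a, μ, h, rfl⟩
    exact L.label_mem _ h

/-! ### Projections of a tree counterexample

Let `M` be an execution mapping from a tree `C` to a composition, let `f` be one of the two
components of `M` and let `β` be the alphabet of the corresponding component LPTS. A transition
of `C` with a label in `β` is matched by a product distribution one factor of which is the
contribution `ν` of that component; a transition with another label leaves that component where
it is. The projection of `C` onto the component is obtained by merging the start of a transition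
with a label outside `β` with all its successors, and by merging any two successors of one
transition that agree in the component; the remaining transitions then have exactly the
distributions `ν` contributed by the component. -/

/-- The elementary mergers. (For a transition with a label outside `β`, the condition
`f c = f c'` holds automatically if `f` comes from an execution mapping.) -/
def projMerge (C : LPTS.{u, v} Act) (β : Set Act) {X : Type*} (f : C.State → X)
    (c c' : C.State) : Prop :=
  f c = f c' ∧ ∃ t ∈ C.trans, c' ∈ t.2.2.supp ∧ (c ∈ t.2.2.supp ∨ (t.2.1 ∉ β ∧ c = t.1))

/-- The equivalence relation generated by the elementary mergers. -/
def projSetoid (C : LPTS.{u, v} Act) (β : Set Act) {X : Type*} (f : C.State → X) :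
    Setoid C.State :=
  Relation.EqvGen.setoid (C.projMerge β f)

theorem projSetoid_eq (C : LPTS.{u, v} Act) (β : Set Act) {X : Type*} (f : C.State → X)
    (c c' : C.State) (h : (C.projSetoid β f) c c') : f c = f c' := by
  change Relation.EqvGen _ _ _ at h
  induction h with
  | rel _ _ h => exact h.1
  | refl _ => rfl
  | symm _ _ _ ih => exact ih.symm
  | trans _ _ _ _ _ ih₁ ih₂ => exact ih₁.trans ih₂

/-- The projection of `C` onto the component with alphabet `β` and component map `f`. -/
noncomputable def proj (C : LPTS.{u, v} Act) (β : Set Act) {X : Type*} (f : C.State → X) :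
    LPTS.{u, v} Act where
  State := Quotient (C.projSetoid β f)
  fintypeState := Fintype.ofFinite _
  start := Quotient.mk _ C.start
  alphabet := C.alphabet ∩ β
  alphabet_finite := C.alphabet_finite.inter_of_left _
  trans :=
    letI : Fintype (Quotient (C.projSetoid β f)) := Fintype.ofFinite _
    {t | ∃ c a μ, (c, a, μ) ∈ C.trans ∧ a ∈ β ∧
      t = (Quotient.mk (C.projSetoid β f) c, a, ProbDist.map (Quotient.mk _) μ)}
  trans_finite := by
    let : Fintype (Quotient (C.projSetoid β f)) := Fintype.ofFinite _
    refine (C.trans_finite.image fun t =>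
      (Quotient.mk (C.projSetoid β f) t.1, t.2.1, ProbDist.map (Quotient.mk _) t.2.2)).subset ?_
    rintro t ⟨c, a, μ, h, -, rfl⟩
    exact ⟨_, h, rfl⟩
  label_mem := by
    rintro t ⟨c, a, μ, h, ha, rfl⟩
    exact ⟨C.label_mem _ h, ha⟩

/-- The mapping from the projection to the component that is induced by `f`. -/
def projMap (C : LPTS.{u, v} Act) (β : Set Act) {X : Type*} (f : C.State → X) :
    (C.proj β f).State → X :=
  Quotient.lift f (C.projSetoid_eq β f)

/-! ### Counterexample analysis and refinement

Below `C` is a tree with a mapping `M` to the quotient `L/q`. -/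

/-- An order in which the transitions of `C` are considered in a bottom-up traversal: each is
considered once, and a transition comes after all transitions of the states in its support. -/
def IsBottomUpOrder (C : LPTS.{u, v} Act) (l : List (C.State × Act × ProbDist C.State)) : Prop :=
  l.Nodup ∧ (∀ t, t ∈ l ↔ t ∈ C.trans) ∧ l.Pairwise fun t t' => t'.1 ∉ t.2.2.supp

/-- The initial candidate `R_M`. -/
def initialRel {C L : LPTS.{u, v} Act} (q : Setoid L.State) (M : C.State → Quotient q) :
    C.State → L.State → Prop :=
  fun c s => M c = Quotient.mk q s

/-- One iteration, for the transition `t` of `C`: remove from `R` the pairs `(t.1, s)` such that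
`s` has no transition that matches `t`. -/
def prune {C : LPTS.{u, v} Act} (L : LPTS.{u, v} Act) (t : C.State × Act × ProbDist C.State)
    (R : C.State → L.State → Prop) : C.State → L.State → Prop :=
  fun c s => R c s ∧
    (c = t.1 → ∃ ν, (s, t.2.1, ν) ∈ L.trans ∧ ProbDist.Below R t.2.2 ν)

/-- Split the class of `q` that contains `T` into `T` and the rest. -/
def splitBy {S : Type*} (q : Setoid S) (T : Set S) : Setoid S where
  r s s' := q s s' ∧ (s ∈ T ↔ s' ∈ T)
  iseqv := ⟨fun s => ⟨q.refl s, Iff.rfl⟩, fun h => ⟨q.symm h.1, h.2.symm⟩,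
    fun h h' => ⟨q.trans h.1 h'.1, h.2.trans h'.2⟩⟩

/-- The refinement if no state is related to `t.1` any more: split the class `M t.1` into
`Rold t.1` and the rest and, for each `c` in the support of `t`, the class `M c` into `Rold c`
and the rest, unless `M c = M t.1` and this class has already been split. -/
def refineEmpty {C L : LPTS.{u, v} Act} (q : Setoid L.State) (M : C.State → Quotient q)
    (t : C.State × Act × ProbDist C.State) (Rold : C.State → L.State → Prop) :
    Setoid L.State :=
  splitBy q {s | Rold t.1 s} ⊓
    ⨅ c ∈ {c | c ∈ t.2.2.supp ∧ ¬ (M c = M t.1 ∧ splitBy q {s | Rold t.1 s} ≠ q)},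
      splitBy q {s | Rold c s}

/-- The refinement if `t.1` is no longer related to the start state of `L`: split its class into
`Rold t.1 \ R t.1` and the rest. -/
def refineStart {C L : LPTS.{u, v} Act} (q : Setoid L.State)
    (t : C.State × Act × ProbDist C.State) (Rold R : C.State → L.State → Prop) :
    Setoid L.State :=
  splitBy q {s | Rold t.1 s ∧ ¬ R t.1 s}

open Classical in
/-- The analysis, run on the list of transitions still to be considered and the current
candidate relation. The result `none` means that the counterexample is real, and `some q'` that
it is spurious and that the partition is refined to `q'`. -/
noncomputable def analyze {C L : LPTS.{u, v} Act} (q : Setoid L.State)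
    (M : C.State → Quotient q) :
    List (C.State × Act × ProbDist C.State) → (C.State → L.State → Prop) →
      Option (Setoid L.State)
  | [], _ => none
  | t :: l, Rold =>
    let R := prune L t Rold
    if ∀ s, ¬ R t.1 s then some (refineEmpty q M t Rold)
    else if M t.1 = Quotient.mk q L.start ∧ Rold t.1 L.start ∧ ¬ R t.1 L.start then
      some (refineStart q t Rold R)
    else analyze q M l R

/-- The procedure `analyzeAndRefine`, started on the initial candidate. -/
noncomputable def analyzeAndRefine {C L : LPTS.{u, v} Act} (q : Setoid L.State)
    (M : C.State → Quotient q) (l : List (C.State × Act × ProbDist C.State)) :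
    Option (Setoid L.State) :=
  analyze q M l (initialRel q M)

end LPTS

/-! ### The algorithm

The assumption is always a quotient of `L₂`, so a state of the loop is a partition of the states
of `L₂`. The choice of the tree counterexample and of the traversal order is nondeterministic. -/

namespace AGAR

variable {Act : Type u}

/-- A counterexample that may be obtained in a loop iteration: a tree `C` with an execution
mapping `M` to `L₁ ∥ (L₂/q)` that is a counterexample to `L₁ ∥ (L₂/q) ⪯ P`. -/
structure Obtained (L₁ L₂ P : LPTS.{u, v} Act) (q : Setoid L₂.State) (C : LPTS.{u, v} Act)
    (M : C.State → L₁.State × Quotient q) : Prop where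
  isTree : C.IsTree
  isExecutionMapping : C.IsExecutionMapping (L₁.comp (L₂.quot q)) M
  isCounterexample : C.IsCounterexample (L₁.comp (L₂.quot q)) P

/-- The projection of an obtained counterexample onto the assumption `L₂/q`. -/
noncomputable abbrev projAssumption {L₁ L₂ : LPTS.{u, v} Act} {q : Setoid L₂.State}
    (C : LPTS.{u, v} Act) (M : C.State → L₁.State × Quotient q) : LPTS.{u, v} Act :=
  C.proj (L₂.quot q).alphabet fun c => (M c).2

/-- The mapping from the projection to the assumption `L₂/q`. -/
def projAssumptionMap {L₁ L₂ : LPTS.{u, v} Act} {q : Setoid L₂.State}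
    (C : LPTS.{u, v} Act) (M : C.State → L₁.State × Quotient q) :
    (projAssumption C M).State → Quotient q :=
  C.projMap (L₂.quot q).alphabet fun c => (M c).2

/-- What the algorithm returns. -/
inductive Outcome (Act : Type u) : Type (max u (v + 1))
  | counterexample (C : LPTS.{u, v} Act) : Outcome Act
  | holds : Outcome Act

/-- A loop iteration that refines the partition `q` to `q'`. -/
inductive Refines (L₁ L₂ P : LPTS.{u, v} Act) (q q' : Setoid L₂.State) : Prop
  | intro (guard : ¬ (L₁.comp (L₂.quot q)).Conforms P)
      (C : LPTS.{u, v} Act) (M : C.State → L₁.State × Quotient q)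
      (obtained : Obtained L₁ L₂ P q C M)
      (l : List ((projAssumption C M).State × Act × ProbDist (projAssumption C M).State))
      (order : (projAssumption C M).IsBottomUpOrder l)
      (spurious : LPTS.analyzeAndRefine q (projAssumptionMap C M) l = some q')

/-- At the partition `q` the algorithm stops and returns the given outcome: either the loop
guard fails, or the obtained counterexample is found not to be spurious. -/
inductive Returns (L₁ L₂ P : LPTS.{u, v} Act) (q : Setoid L₂.State) : Outcome.{u, v} Act → Prop
  | holds (guard : (L₁.comp (L₂.quot q)).Conforms P) : Returns L₁ L₂ P q Outcome.holds
  | counterexample (guard : ¬ (L₁.comp (L₂.quot q)).Conforms P)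
      (C : LPTS.{u, v} Act) (M : C.State → L₁.State × Quotient q)
      (obtained : Obtained L₁ L₂ P q C M)
      (l : List ((projAssumption C M).State × Act × ProbDist (projAssumption C M).State))
      (order : (projAssumption C M).IsBottomUpOrder l)
      (not_spurious : LPTS.analyzeAndRefine q (projAssumptionMap C M) l = none) :
      Returns L₁ L₂ P q (Outcome.counterexample C)

/-- `Reaches L₁ L₂ P n q`: some run of the algorithm, which starts with the coarsest partition,
has the current partition `q` after `n` refinements. -/
inductive Reaches (L₁ L₂ P : LPTS.{u, v} Act) : ℕ → Setoid L₂.State → Prop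
  | init : Reaches L₁ L₂ P 0 ⊤
  | step {n : ℕ} {q q' : Setoid L₂.State} (before : Reaches L₁ L₂ P n q)
      (refines : Refines L₁ L₂ P q q') : Reaches L₁ L₂ P (n + 1) q'

end AGAR

/-! Termination: every refinement makes the partition strictly finer, so the number of classes,
initially one, grows each time and never exceeds `|S₂|`. The crux is `refineEmpty_lt`. If no split
in case (i) were proper, the rows of the source and of all successors would be whole classes. The
transition of the assumption matching the pruned one comes from a transition of some concrete state
`s` of the source class, and `s` would then survive the pruning. In case (ii) the split separates
the removed start state from a survivor.

Correctness: the answer "holds" is sound because `L₁ ∥ L₂ ⪯ L₁ ∥ (L₂/q)` (`comp_sim_comp_quot`) and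
simulation is transitive. If the analysis finds nothing spurious, the final candidate is a strong
simulation of the projection by `L₂` (`analyze_none`), because bottom-up pruning never touches a row
after it has been used in a match. Combined with the first component of the execution mapping, it
simulates `C` by `L₁ ∥ L₂` (`IsExecutionMapping.sim_comp`).

Progress: the approximants of similarity on a finite product stabilise, so non-similarity shows at a
finite depth `N`, and the tree of paths of length at most `N` already witnesses it. Counting the
labels visible to `L₂` on the path to a state gives a depth that survives projection and orders the
transitions bottom-up. -/

namespace ProbDist

/-! ### Calculus of weight functions -/

section Below

variable {S T U V : Type*} [Fintype S] [Fintype T] [Fintype U] [Fintype V]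

theorem prob_le_one (μ : ProbDist S) (s : S) : μ.prob s ≤ 1 := by
  rw [← μ.sum_eq_one]
  exact Finset.single_le_sum (fun t _ => μ.nonneg t) (Finset.mem_univ s)

theorem prob_eq_zero {μ : ProbDist S} {s : S} (h : s ∉ μ.supp) : μ.prob s = 0 :=
  le_antisymm (not_lt.1 h) (μ.nonneg s)

open Classical in
theorem map_prob (f : S → T) (μ : ProbDist S) (t : T) :
    (map f μ).prob t = ∑ s, if f s = t then μ.prob s else 0 := by
  rw [← Finset.sum_filter]
  rfl

theorem mem_supp_map {f : S → T} {μ : ProbDist S} {t : T} :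
    t ∈ (map f μ).supp ↔ ∃ s ∈ μ.supp, f s = t := by
  classical
  constructor
  · intro h
    by_contra! hne
    refine ne_of_gt (show 0 < (map f μ).prob t from h) ?_
    rw [map_prob]
    refine Finset.sum_eq_zero fun s _ => ?_
    split_ifs with hs
    · exact prob_eq_zero fun hs' => hne s hs' hs
    · rfl
  · rintro ⟨s, hs, rfl⟩
    refine lt_of_lt_of_le (show 0 < μ.prob s from hs) ?_
    rw [map_prob]
    refine le_trans (by simp) (Finset.single_le_sum (f := fun s' => if f s' = f s then μ.prob s'
      else 0) (fun t _ => ?_) (Finset.mem_univ s))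
    split_ifs
    exacts [μ.nonneg t, le_rfl]

theorem map_prob_of_injOn {f : S → T} {μ : ProbDist S} (hf : Set.InjOn f μ.supp) {s : S}
    (hs : s ∈ μ.supp) : (map f μ).prob (f s) = μ.prob s := by
  classical
  rw [map_prob, Finset.sum_eq_single s]
  · simp
  · intro t _ hts
    split_ifs with h
    · exact prob_eq_zero fun ht => hts (hf ht hs h)
    · rfl
  · simp

theorem mem_supp_dirac {s t : S} : t ∈ (dirac s).supp ↔ t = s := by
  classical
  change 0 < (if t = s then (1 : ℚ) else 0) ↔ _
  split_ifs with h <;> simp [h]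

/-- The bound `w ≤ 1` on a weight function follows from its marginals. -/
theorem Below.of_weight {R : S → T → Prop} {μ : ProbDist S} {ν : ProbDist T} (w : S → T → ℚ)
    (h0 : ∀ s t, 0 ≤ w s t) (hμ : ∀ s, μ.prob s = ∑ t, w s t) (hν : ∀ t, ν.prob t = ∑ s, w s t)
    (hR : ∀ s t, 0 < w s t → R s t) : Below R μ ν := by
  refine ⟨w, fun s t => ⟨h0 s t, ?_⟩, hμ, hν, hR⟩
  refine le_trans ?_ (μ.prob_le_one s)
  rw [hμ]
  exact Finset.single_le_sum (fun t _ => h0 s t) (Finset.mem_univ t)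

/-- A positive weight forces both marginals to be positive, so only pairs in the two supports
matter. -/
theorem Below.mono {R R' : S → T → Prop} {μ : ProbDist S} {ν : ProbDist T} (h : Below R μ ν)
    (hR : ∀ s ∈ μ.supp, ∀ t ∈ ν.supp, R s t → R' s t) : Below R' μ ν := by
  obtain ⟨w, h0, hμ, hν, hw⟩ := h
  refine ⟨w, h0, hμ, hν, fun s t hst => hR s ?_ t ?_ (hw s t hst)⟩
  · refine lt_of_lt_of_le hst ?_
    rw [hμ]
    exact Finset.single_le_sum (fun t _ => (h0 s t).1) (Finset.mem_univ t)
  · refine lt_of_lt_of_le hst ?_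
    rw [hν]
    exact Finset.single_le_sum (f := fun s => w s t) (fun s _ => (h0 s t).1) (Finset.mem_univ s)

theorem Below.flip {R : S → T → Prop} {μ : ProbDist S} {ν : ProbDist T} (h : Below R μ ν) :
    Below (fun t s => R s t) ν μ := by
  obtain ⟨w, h0, hμ, hν, hw⟩ := h
  exact ⟨fun t s => w s t, fun t s => h0 s t, hν, hμ, fun t s => hw s t⟩

/-- The two couplings are glued along `ν`, making the outer coordinates conditionally independent
given the middle one. -/
theorem Below.trans {R : S → T → Prop} {R' : T → U → Prop} {μ : ProbDist S} {ν : ProbDist T}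
    {ρ : ProbDist U} (h : Below R μ ν) (h' : Below R' ν ρ) :
    Below (fun s r => ∃ t ∈ ν.supp, R s t ∧ R' t r) μ ρ := by
  obtain ⟨w, h0, hμ, hν, hw⟩ := h
  obtain ⟨w', h0', hν', hρ, hw'⟩ := h'
  have hz : ∀ s t, ν.prob t = 0 → w s t = 0 := fun s t ht => by
    rw [hν] at ht
    exact (Finset.sum_eq_zero_iff_of_nonneg fun s _ => (h0 s t).1).1 ht s (Finset.mem_univ s)
  have hz' : ∀ t r, ν.prob t = 0 → w' t r = 0 := fun t r ht => by
    rw [hν'] at ht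
    exact (Finset.sum_eq_zero_iff_of_nonneg fun r _ => (h0' t r).1).1 ht r (Finset.mem_univ r)
  have hnn : ∀ s t r, 0 ≤ w s t * w' t r / ν.prob t := fun s t r =>
    div_nonneg (mul_nonneg (h0 s t).1 (h0' t r).1) (ν.nonneg t)
  -- Where `ν.prob t = 0` the quotient is `0` by convention; this is the right value, since `hz` and
  -- `hz'` make both weights vanish there.
  refine Below.of_weight (fun s r => ∑ t, w s t * w' t r / ν.prob t)
    (fun s r => Finset.sum_nonneg fun t _ => hnn s t r) ?_ ?_ ?_
  · intro s
    rw [Finset.sum_comm, hμ]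
    refine Finset.sum_congr rfl fun t _ => ?_
    rw [← Finset.sum_div, ← Finset.mul_sum, ← hν']
    by_cases ht : ν.prob t = 0
    · simp [hz s t ht]
    · field_simp
  · intro r
    rw [Finset.sum_comm, hρ]
    refine Finset.sum_congr rfl fun t _ => ?_
    rw [← Finset.sum_div, ← Finset.sum_mul, ← hν]
    by_cases ht : ν.prob t = 0
    · simp [hz' t r ht]
    · field_simp
  · intro s r hsr
    obtain ⟨t, -, ht⟩ := Finset.exists_ne_zero_of_sum_ne_zero hsr.ne'
    have hνt : ν.prob t ≠ 0 := fun h => ht (by rw [h, div_zero])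
    refine ⟨t, lt_of_le_of_ne (ν.nonneg t) hνt.symm, hw s t ?_, hw' t r ?_⟩
    · exact lt_of_le_of_ne (h0 s t).1 fun h => ht (by rw [← h, zero_mul, zero_div])
    · exact lt_of_le_of_ne (h0' t r).1 fun h => ht (by rw [← h, mul_zero, zero_div])

theorem Below.prod {R : S → T → Prop} {R' : U → V → Prop} {μ : ProbDist S} {ν : ProbDist T}
    {μ' : ProbDist U} {ν' : ProbDist V} (h : Below R μ ν) (h' : Below R' μ' ν') :
    Below (fun p p' => R p.1 p'.1 ∧ R' p.2 p'.2) (μ.prod μ') (ν.prod ν') := by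
  obtain ⟨w, h0, hμ, hν, hw⟩ := h
  obtain ⟨w', h0', hμ', hν', hw'⟩ := h'
  refine Below.of_weight (fun p p' => w p.1 p'.1 * w' p.2 p'.2)
    (fun p p' => mul_nonneg (h0 _ _).1 (h0' _ _).1) ?_ ?_ ?_
  · rintro ⟨s, r⟩
    change μ.prob s * μ'.prob r = _
    rw [hμ, hμ', Fintype.sum_mul_sum, Fintype.sum_prod_type]
  · rintro ⟨s, r⟩
    change ν.prob s * ν'.prob r = _
    rw [hν, hν', Fintype.sum_mul_sum, Fintype.sum_prod_type]
  · intro p p' hp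
    exact ⟨hw _ _ (pos_of_mul_pos_left hp (h0' _ _).1),
      hw' _ _ (pos_of_mul_pos_right hp (h0 _ _).1)⟩

theorem below_map (f : S → T) (μ : ProbDist S) : Below (fun s t => f s = t) μ (map f μ) := by
  classical
  refine Below.of_weight (fun s t => if f s = t then μ.prob s else 0) (fun s t => ?_) (fun s => ?_)
    (map_prob f μ) (fun s t h => ?_)
  · split_ifs
    exacts [μ.nonneg s, le_rfl]
  · simp
  · by_contra hne
    simp [hne] at h

theorem map_id' (μ : ProbDist S) : map (fun s => s) μ = μ := by
  classical
  ext t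
  simp [map_prob]

theorem below_refl (μ : ProbDist S) : Below (fun s t => s = t) μ μ := by
  simpa only [map_id'] using below_map (fun s => s) μ

theorem map_snd_prod (μ : ProbDist S) (ν : ProbDist T) : map Prod.snd (μ.prod ν) = ν := by
  classical
  ext t
  rw [map_prob, Fintype.sum_prod_type]
  simp only [Finset.sum_ite_eq', Finset.mem_univ, if_true, prod]
  rw [← Finset.sum_mul, μ.sum_eq_one, one_mul]

theorem below_dirac {R : S → T → Prop} {s : S} {t : T} (h : R s t) :
    Below R (dirac s) (dirac t) := by
  classical
  have hmap : map (fun _ => t) (dirac s) = dirac t := by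
    ext t'
    rw [map_prob]
    by_cases ht : t = t'
    · subst ht
      simp [dirac]
    · simp [dirac, ht, Ne.symm ht]
  rw [← hmap]
  refine (below_map _ _).mono fun s' hs' t' _ ht' => ?_
  rw [mem_supp_dirac.1 hs', ← ht']
  exact h

/-- A distribution that agrees with `ν` along a map that is injective on its support. -/
theorem map_eq_of_injOn {f : S → T} {μ : ProbDist S} {ν : ProbDist T}
    (hf : Set.InjOn f μ.supp) (h : ∀ s ∈ μ.supp, μ.prob s = ν.prob (f s)) : map f μ = ν := by
  -- A pointwise inequality between two functions of total mass `1` is an equality; in particular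
  -- `ν` has no mass outside the image of the support of `μ`.
  have hle : ∀ t ∈ Finset.univ, (map f μ).prob t ≤ ν.prob t := by
    intro t _
    by_cases ht : t ∈ (map f μ).supp
    · obtain ⟨s, hs, rfl⟩ := mem_supp_map.1 ht
      rw [map_prob_of_injOn hf hs, h s hs]
    · rw [prob_eq_zero ht]
      exact ν.nonneg t
  have hsum : ∑ t, (map f μ).prob t = ∑ t, ν.prob t := by rw [sum_eq_one, sum_eq_one]
  ext t
  exact (Finset.sum_eq_sum_iff_of_le hle).1 hsum t (Finset.mem_univ t)

end Below

end ProbDist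

/-! ### Simulations, compositions and quotients -/

namespace LPTS

variable {Act : Type u}

open ProbDist

theorem Sim.trans {L₁ L₂ L₃ : LPTS.{u, v} Act} (h : L₁.Sim L₂) (h' : L₂.Sim L₃) :
    L₁.Sim L₃ := by
  obtain ⟨R, hR, h0⟩ := h
  obtain ⟨R', hR', h0'⟩ := h'
  refine ⟨fun s r => ∃ t, R s t ∧ R' t r, ?_, L₂.start, h0, h0'⟩
  rintro s r ⟨t, hst, htr⟩ a μ hμ
  obtain ⟨ν, hν, hμν⟩ := hR s t hst a μ hμ
  obtain ⟨ρ, hρ, hνρ⟩ := hR' t r htr a ν hν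
  refine ⟨ρ, hρ, (hμν.trans hνρ).mono ?_⟩
  rintro x - y - ⟨z, -, hz⟩
  exact ⟨z, hz⟩

/-- Functional simulations. -/
theorem Sim.of_map {L₁ L₂ : LPTS.{u, v} Act} (f : L₁.State → L₂.State)
    (h0 : f L₁.start = L₂.start)
    (h : ∀ s a μ, (s, a, μ) ∈ L₁.trans →
      ∃ ν, (f s, a, ν) ∈ L₂.trans ∧ Below (fun s t => f s = t) μ ν) : L₁.Sim L₂ := by
  refine ⟨fun s t => f s = t, ?_, h0⟩
  rintro s _ rfl a μ hμ
  exact h s a μ hμ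

theorem IsExecutionMapping.below {C L : LPTS.{u, v} Act} {M : C.State → L.State}
    (hM : C.IsExecutionMapping L M) {c : C.State} {a : Act} {μ : ProbDist C.State}
    (hc : (c, a, μ) ∈ C.trans) :
    ∃ ν, (M c, a, ν) ∈ L.trans ∧ Below (fun s t => M s = t) μ ν := by
  obtain ⟨ν, hν, hinj, hprob⟩ := hM.map_trans c a μ hc
  refine ⟨ν, hν, ?_⟩
  rw [← map_eq_of_injOn hinj hprob]
  exact below_map M μ

theorem IsExecutionMapping.sim {C L : LPTS.{u, v} Act} {M : C.State → L.State}
    (hM : C.IsExecutionMapping L M) : C.Sim L :=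
  Sim.of_map M hM.map_start fun _ _ _ hc => hM.below hc

/-- A transition of a composition decomposes into the contributions of the components, and the
contribution of the second component can be exchanged. -/
theorem comp_trans_cases {L A : LPTS.{u, v} Act} {p : L.State × A.State} {a : Act}
    {ν : ProbDist (L.State × A.State)} (h : (p, a, ν) ∈ (L.comp A).trans) :
    ∃ (ν₁ : ProbDist L.State) (ν₂ : ProbDist A.State), ν = ν₁.prod ν₂ ∧
      ((a ∈ A.alphabet ∧ (p.2, a, ν₂) ∈ A.trans ∧
          ∀ B : LPTS.{u, v} Act, ∀ s ν', (s, a, ν') ∈ B.trans →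
            ((p.1, s), a, ν₁.prod ν') ∈ (L.comp B).trans) ∨
        (a ∉ A.alphabet ∧ ν₂ = dirac p.2 ∧
          ∀ B : LPTS.{u, v} Act, a ∉ B.alphabet → ∀ s,
            ((p.1, s), a, ν₁.prod (dirac s)) ∈ (L.comp B).trans)) := by
  rcases h with ⟨s₁, s₂, b, μ₁, μ₂, h₁, h₂, he⟩ | ⟨s₁, s₂, b, μ₁, h₁, hb, he⟩ |
    ⟨s₁, s₂, b, μ₂, hb, h₂, he⟩ <;> cases he
  · exact ⟨μ₁, μ₂, rfl, Or.inl ⟨A.label_mem _ h₂, h₂, fun B s ν' h =>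
      Or.inl ⟨_, _, _, _, _, h₁, h, rfl⟩⟩⟩
  · exact ⟨μ₁, _, rfl, Or.inr ⟨hb, rfl, fun B hB s => Or.inr (Or.inl ⟨_, _, _, _, h₁, hB, rfl⟩)⟩⟩
  · exact ⟨_, μ₂, rfl, Or.inl ⟨A.label_mem _ h₂, h₂, fun B s ν' h =>
      Or.inr (Or.inr ⟨_, _, _, _, hb, h, rfl⟩)⟩⟩

theorem mem_quot_trans {L : LPTS.{u, v} Act} {q : Setoid L.State} {x : (L.quot q).State} {a : Act}
    {ν : ProbDist (L.quot q).State} :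
    (x, a, ν) ∈ (L.quot q).trans ↔ ∃ s μ, (s, a, μ) ∈ L.trans ∧
      Quotient.mk q s = x ∧ ν = map (T := (L.quot q).State) (Quotient.mk q) μ := by
  constructor
  · rintro ⟨s, b, μ, h, he⟩
    cases he
    exact ⟨s, μ, h, rfl, rfl⟩
  · rintro ⟨s, μ, h, rfl, rfl⟩
    exact ⟨s, a, μ, h, rfl⟩

/-- Passing to classes in the second component is a functional simulation, as quotient transitions
carry exactly the image distributions. -/
theorem comp_sim_comp_quot (L₁ L₂ : LPTS.{u, v} Act) (q : Setoid L₂.State) :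
    (L₁.comp L₂).Sim (L₁.comp (L₂.quot q)) := by
  refine Sim.of_map (L₂ := L₁.comp (L₂.quot q)) (fun p => (p.1, Quotient.mk q p.2)) rfl ?_
  rintro p a ν h
  obtain ⟨ν₁, ν₂, rfl, ⟨-, h₂, hB⟩ | ⟨ha, rfl, hB⟩⟩ := comp_trans_cases h
  · refine ⟨_, hB (L₂.quot q) (Quotient.mk q p.2) _ (mem_quot_trans.2 ⟨_, _, h₂, rfl, rfl⟩),
      ((below_refl ν₁).prod (below_map (T := (L₂.quot q).State) (Quotient.mk q) ν₂)).mono ?_⟩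
    rintro ⟨s, t⟩ - ⟨s', t'⟩ - ⟨rfl, rfl⟩
    rfl
  · refine ⟨_, hB (L₂.quot q) ha (Quotient.mk q p.2), ((below_refl ν₁).prod
      (below_dirac (T := (L₂.quot q).State) (R := fun s t => Quotient.mk q s = t) rfl)).mono ?_⟩
    rintro ⟨s, t⟩ - ⟨s', t'⟩ - ⟨rfl, rfl⟩
    rfl

/-- A quotient keeps the alphabet, so both sides complete `P` in the same way, definitionally. -/
theorem Conforms.of_quot {L₁ L₂ P : LPTS.{u, v} Act} {q : Setoid L₂.State}
    (h : (L₁.comp (L₂.quot q)).Conforms P) : (L₁.comp L₂).Conforms P :=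
  (comp_sim_comp_quot L₁ L₂ q).trans h

end LPTS

namespace LPTS

variable {Act : Type u}

open ProbDist

/-! ### Counterexample analysis: strict refinement and soundness -/

section Analysis

variable {D L : LPTS.{u, v} Act}

theorem splitBy_le {S : Type*} (q : Setoid S) (T : Set S) : splitBy q T ≤ q := fun _ _ h => h.1

theorem splitBy_lt {S : Type*} {q : Setoid S} {T : Set S} {s s' : S} (h : q s s') (hs : s ∈ T)
    (hs' : s' ∉ T) : splitBy q T < q :=
  lt_of_le_not_ge (splitBy_le q T) fun hle => hs' ((hle h).2.1 hs)

theorem mem_of_splitBy_eq {S : Type*} {q : Setoid S} {T : Set S} {s s' : S}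
    (hq : splitBy q T = q) (h : q s s') (hs : s ∈ T) : s' ∈ T := by
  rw [← hq] at h
  exact h.2.1 hs

/-- The map `M` matches the transitions of `D` by transitions of `L`. -/
def Matches (D L : LPTS.{u, v} Act) (M : D.State → L.State) : Prop :=
  ∀ c a μ, (c, a, μ) ∈ D.trans →
    ∃ ν, (M c, a, ν) ∈ L.trans ∧ Below (fun s t => M s = t) μ ν

/-- A nonempty row whose split is trivial is a full class. If all splits were trivial, a concrete
transition behind the quotient transition that matches `t` would match `t` itself, contradicting the
empty row. -/
theorem refineEmpty_lt {q : Setoid L.State} {M : D.State → Quotient q}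
    (hM : Matches D (L.quot q) M) {t : D.State × Act × ProbDist D.State} (ht : t ∈ D.trans)
    {R : D.State → L.State → Prop} (hne : ∀ c, ∃ s, R c s)
    (hR : ∀ c s, R c s → M c = Quotient.mk q s) (hempty : ∀ s, ¬ prune L t R t.1 s) :
    refineEmpty q M t R < q := by
  have hle : refineEmpty q M t R ≤ splitBy q {s | R t.1 s} := inf_le_left
  by_cases hsplit : splitBy q {s | R t.1 s} = q
  swap
  · exact lt_of_le_of_lt hle (lt_of_le_of_ne (splitBy_le _ _) hsplit)
  refine lt_of_le_of_ne (hle.trans (splitBy_le _ _)) fun heq => ?_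
  have hfull : ∀ c, splitBy q {s | R c s} = q → ∀ s, M c = Quotient.mk q s → R c s := by
    intro c hc s hs
    obtain ⟨s', hs'⟩ := hne c
    exact mem_of_splitBy_eq hc (Quotient.exact ((hR c s' hs').symm.trans hs)) hs'
  -- The exemption from splitting requires the source class to have been properly split, which
  -- `hsplit` excludes; so every successor contributes to the infimum.
  have hsupp : ∀ c ∈ t.2.2.supp, splitBy q {s | R c s} = q := by
    intro c hc
    refine le_antisymm (splitBy_le _ _) ?_
    conv_lhs => rw [← heq]
    exact inf_le_right.trans (iInf₂_le c ⟨hc, fun h => h.2 hsplit⟩)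
  obtain ⟨c, a, μ⟩ := t
  obtain ⟨ν, hν, hbelow⟩ := hM c a μ ht
  obtain ⟨s, ρ, hs, hsc, rfl⟩ := mem_quot_trans.1 hν
  refine hempty s ⟨hfull c hsplit s hsc.symm, fun _ => ⟨ρ, hs, ?_⟩⟩
  -- Couple `c'` with `s'` through their common class; since the row of `c'` is that full class,
  -- they are related by `R`.
  refine (hbelow.trans (below_map (T := (L.quot q).State) (Quotient.mk q) ρ).flip).mono ?_
  rintro c' hc' s' - ⟨x, -, hx, hx'⟩
  exact hfull c' (hsupp c' hc') s' (hx.trans hx'.symm)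

/-- Two invariants carry the induction: rows stay nonempty, because case (i) intercepts the first
empty one, and each row lies in its class. In case (ii) the nonempty pruned row provides a state
separated from the start state. -/
theorem analyze_lt {q q' : Setoid L.State} {M : D.State → Quotient q}
    (hM : Matches D (L.quot q) M) :
    ∀ (l : List (D.State × Act × ProbDist D.State)) (R : D.State → L.State → Prop),
      (∀ t ∈ l, t ∈ D.trans) → (∀ c, ∃ s, R c s) → (∀ c s, R c s → M c = Quotient.mk q s) →
      analyze q M l R = some q' → q' < q := by
  intro l
  induction l with
  | nil =>
    intro R _ _ _ h
    simp [analyze] at h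
  | cons t l ih =>
    intro R hl hne hR h
    rw [analyze] at h
    split_ifs at h with h1 h2
    · obtain rfl := Option.some.inj h
      exact refineEmpty_lt hM (hl t List.mem_cons_self) hne hR h1
    · obtain rfl := Option.some.inj h
      push Not at h1
      obtain ⟨s, hs⟩ := h1
      exact splitBy_lt (s := L.start) (s' := s)
        (Quotient.exact (h2.1.symm.trans (hR _ _ hs.1))) h2.2 fun h => h.2 hs
    · refine ih _ (fun t' ht' => hl t' (List.mem_cons_of_mem _ ht')) (fun c => ?_)
        (fun c s hs => hR c s hs.1) h
      by_cases hc : c = t.1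
      · subst hc
        push Not at h1
        exact h1
      · obtain ⟨s, hs⟩ := hne c
        exact ⟨s, hs, fun h => absurd h hc⟩

theorem analyzeAndRefine_lt {q q' : Setoid L.State} {M : D.State → Quotient q}
    (hM : Matches D (L.quot q) M) {l : List (D.State × Act × ProbDist D.State)}
    (hl : D.IsBottomUpOrder l) (h : analyzeAndRefine q M l = some q') : q' < q :=
  analyze_lt hM l (initialRel q M) (fun t => (hl.2.1 t).1)
    (fun c => (Quotient.exists_rep (M c)).imp fun _ => Eq.symm) (fun _ _ => id) h

/-- The third conjunct is what makes the induction work: a row changes only when a transition from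
its state is processed. Hence matches established by a pruning step remain valid for the final
relation. -/
theorem analyze_none {q : Setoid L.State} {M : D.State → Quotient q} :
    ∀ (l : List (D.State × Act × ProbDist D.State)) (R₀ : D.State → L.State → Prop),
      (l.Pairwise fun t t' => t'.1 ∉ t.2.2.supp) → (∀ t ∈ l, t.1 ∉ t.2.2.supp) →
      analyze q M l R₀ = none →
      ∃ R : D.State → L.State → Prop,
        (∀ c s, R c s → R₀ c s) ∧
        (∀ t ∈ l, ∀ s, R t.1 s → ∃ ν, (s, t.2.1, ν) ∈ L.trans ∧ Below R t.2.2 ν) ∧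
        (∀ c, (∀ t ∈ l, t.1 ≠ c) → ∀ s, R₀ c s → R c s) ∧
        (∀ c, M c = Quotient.mk q L.start → R₀ c L.start → R c L.start) := by
  intro l
  induction l with
  | nil =>
    intro R₀ _ _ _
    exact ⟨R₀, fun _ _ => id, by simp, fun _ _ _ => id, fun _ _ => id⟩
  | cons t l ih =>
    intro R₀ hp hirr h
    rw [analyze] at h
    split_ifs at h with h1 h2
    rw [List.pairwise_cons] at hp
    obtain ⟨R, hle, hmatch, hrow, hstart⟩ := ih _ hp.2
      (fun t' ht' => hirr t' (List.mem_cons_of_mem _ ht')) h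
    refine ⟨R, fun c s hs => (hle c s hs).1, ?_, ?_, ?_⟩
    · intro t' ht' s hs
      rcases List.mem_cons.1 ht' with rfl | ht'
      · obtain ⟨ν, hν, hbelow⟩ := (hle _ _ hs).2 rfl
        -- Rows over the support are already final: no later transition starts there, and neither
        -- does the present one.
        refine ⟨ν, hν, hbelow.mono fun c hc s' _ hs' => hrow c ?_ s' ⟨hs', ?_⟩⟩
        · rintro t'' ht'' rfl
          exact hp.1 t'' ht'' hc
        · rintro rfl
          exact absurd hc (hirr _ List.mem_cons_self)
      · exact hmatch t' ht' s hs
    · intro c hc s hs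
      exact hrow c (fun t' ht' => hc t' (List.mem_cons_of_mem _ ht')) s
        ⟨hs, fun h => absurd h.symm (hc t List.mem_cons_self)⟩
    · intro c hc hs
      refine hstart c hc ?_
      by_contra hns
      by_cases hct : c = t.1
      · subst hct
        exact h2 ⟨hc, hs, hns⟩
      · exact hns ⟨hs, fun h => absurd h hct⟩

theorem analyzeAndRefine_none {q : Setoid L.State} {M : D.State → Quotient q}
    {l : List (D.State × Act × ProbDist D.State)} (hl : D.IsBottomUpOrder l)
    (hirr : ∀ t ∈ D.trans, t.1 ∉ t.2.2.supp) (hstart : M D.start = Quotient.mk q L.start)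
    (h : analyzeAndRefine q M l = none) :
    ∃ R : D.State → L.State → Prop, IsStrongSim D L R ∧ R D.start L.start := by
  obtain ⟨R, -, hmatch, -, hst⟩ := analyze_none l _ hl.2.2
    (fun t ht => hirr t ((hl.2.1 t).1 ht)) h
  exact ⟨R, fun c s hs a μ hμ => hmatch _ ((hl.2.1 _).2 hμ) s hs, hst _ hstart hstart⟩

end Analysis

/-! ### Depth in trees and bottom-up orders -/

section Depth

variable {C : LPTS.{u, v} Act}

/-- `DepthIn C β c n`: a path from the start state to `c` has `n` transitions with labels
in `β`. -/
inductive DepthIn (C : LPTS.{u, v} Act) (β : Set Act) : C.State → ℕ → Prop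
  | start : DepthIn C β C.start 0
  | visible {c c' : C.State} {a : Act} {μ : ProbDist C.State} {n : ℕ} (h : DepthIn C β c n)
      (hc : (c, a, μ) ∈ C.trans) (hc' : c' ∈ μ.supp) (ha : a ∈ β) : DepthIn C β c' (n + 1)
  | hidden {c c' : C.State} {a : Act} {μ : ProbDist C.State} {n : ℕ} (h : DepthIn C β c n)
      (hc : (c, a, μ) ∈ C.trans) (hc' : c' ∈ μ.supp) (ha : a ∉ β) : DepthIn C β c' n

theorem IsTree.trans_eq (hC : C.IsTree) {c : C.State} {t t' : C.State × Act × ProbDist C.State}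
    (ht : t ∈ C.trans) (hc : c ∈ t.2.2.supp) (ht' : t' ∈ C.trans) (hc' : c ∈ t'.2.2.supp) :
    t = t' :=
  (hC.existsUnique c (by rintro rfl; exact hC.start_notMem t ht hc)).unique ⟨ht, hc⟩ ⟨ht', hc'⟩

theorem IsTree.exists_depthIn (hC : C.IsTree) (β : Set Act) (c : C.State) :
    ∃ n, DepthIn C β c n := by
  induction hC.reachable c with
  | refl => exact ⟨0, .start⟩
  | tail _ h ih =>
    obtain ⟨n, hn⟩ := ih
    obtain ⟨a, μ, hc, hc'⟩ := h
    by_cases ha : a ∈ β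
    · exact ⟨n + 1, .visible hn hc hc' ha⟩
    · exact ⟨n, .hidden hn hc hc' ha⟩

/-- Nothing enters the start state and any other state has only one incoming transition, so two
derivations end with the same step. -/
theorem DepthIn.unique (hC : C.IsTree) {β : Set Act} {c : C.State} {n m : ℕ}
    (hn : DepthIn C β c n) (hm : DepthIn C β c m) : n = m := by
  induction hn generalizing m with
  | start =>
    cases hm with
    | start => rfl
    | visible _ hc hc' => exact absurd hc' (hC.start_notMem _ hc)
    | hidden _ hc hc' => exact absurd hc' (hC.start_notMem _ hc)
  | visible h hc hc' ha ih =>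
    cases hm with
    | start => exact absurd hc' (hC.start_notMem _ hc)
    | visible h₂ hc₂ hc₂' _ =>
      cases hC.trans_eq hc hc' hc₂ hc₂'
      rw [ih h₂]
    | hidden _ hc₂ hc₂' ha₂ =>
      cases hC.trans_eq hc hc' hc₂ hc₂'
      exact absurd ha ha₂
  | hidden h hc hc' ha ih =>
    cases hm with
    | start => exact absurd hc' (hC.start_notMem _ hc)
    | visible _ hc₂ hc₂' ha₂ =>
      cases hC.trans_eq hc hc' hc₂ hc₂'
      exact absurd ha₂ ha
    | hidden h₂ hc₂ hc₂' _ =>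
      cases hC.trans_eq hc hc' hc₂ hc₂'
      exact ih h₂

/-- The number of transitions with labels in `β` on the path to a state of a tree. -/
theorem IsTree.exists_depth (hC : C.IsTree) (β : Set Act) :
    ∃ d : C.State → ℕ, ∀ c a μ, (c, a, μ) ∈ C.trans → ∀ c' ∈ μ.supp,
      (a ∈ β → d c' = d c + 1) ∧ (a ∉ β → d c' = d c) := by
  choose d hd using hC.exists_depthIn β
  exact ⟨d, fun c a μ hc c' hc' => ⟨fun ha => (hd c').unique hC (.visible (hd c) hc hc' ha),
    fun ha => (hd c').unique hC (.hidden (hd c) hc hc' ha)⟩⟩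

end Depth

/-- A rank that increases along the transitions gives a bottom-up order. -/
theorem exists_isBottomUpOrder {D : LPTS.{u, v} Act} (d : D.State → ℕ)
    (hd : ∀ t ∈ D.trans, ∀ c ∈ t.2.2.supp, d t.1 < d c) : ∃ l, D.IsBottomUpOrder l := by
  classical
  -- Sort by decreasing rank of the source: a later source has rank at most that of `t.1`, hence is
  -- not in the support of `t`.
  let r : D.State × Act × ProbDist D.State → D.State × Act × ProbDist D.State → Prop :=
    fun t t' => d t'.1 ≤ d t.1
  have : IsTrans _ r := ⟨fun _ _ _ h h' => le_trans h' h⟩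
  have : Std.Total r := ⟨fun _ _ => le_total _ _⟩
  have hperm := List.perm_insertionSort r D.trans_finite.toFinset.toList
  refine ⟨D.trans_finite.toFinset.toList.insertionSort r, ?_, ?_, ?_⟩
  · exact hperm.nodup_iff.2 (Finset.nodup_toList _)
  · intro t
    rw [hperm.mem_iff]
    simp
  · refine (List.pairwise_insertionSort r _).imp_of_mem ?_
    intro t t' ht _ hr hmem
    rw [hperm.mem_iff] at ht
    exact absurd (hd t (by simpa using ht) _ hmem) (not_lt.2 hr)

/-! ### Projection onto the second component -/

section Projection

variable {C L₁ A : LPTS.{u, v} Act}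

theorem mem_proj_trans {β : Set Act} {X : Type*} {f : C.State → X} {k : (C.proj β f).State}
    {a : Act} {κ : ProbDist (C.proj β f).State} :
    (k, a, κ) ∈ (C.proj β f).trans ↔ ∃ c μ, (c, a, μ) ∈ C.trans ∧ a ∈ β ∧
      Quotient.mk (C.projSetoid β f) c = k ∧
        κ = map (T := (C.proj β f).State) (Quotient.mk (C.projSetoid β f)) μ := by
  constructor
  · rintro ⟨c, b, μ, h, hb, he⟩
    cases he
    exact ⟨c, μ, h, hb, rfl, rfl⟩
  · rintro ⟨c, μ, h, ha, rfl, rfl⟩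
    exact ⟨c, a, μ, h, ha, rfl⟩

/-- Counting only labels in `β` makes the depth invariant under both kinds of merger: siblings have
equal depth, and a transition with a label outside `β` does not change it. -/
theorem IsTree.exists_proj_depth (hC : C.IsTree) (β : Set Act) {X : Type*} (f : C.State → X) :
    ∃ d : (C.proj β f).State → ℕ, ∀ t ∈ (C.proj β f).trans, ∀ k ∈ t.2.2.supp, d t.1 < d k := by
  obtain ⟨d, hd⟩ := hC.exists_depth β
  have hinv : ∀ c c', (C.projSetoid β f) c c' → d c = d c' := by
    intro c c' h
    change Relation.EqvGen _ _ _ at h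
    induction h with
    | rel c c' h =>
      obtain ⟨-, ⟨c₀, a, μ⟩, ht, hc', hc | ⟨ha, rfl⟩⟩ := h
      · by_cases ha : a ∈ β
        · rw [(hd _ _ _ ht c hc).1 ha, (hd _ _ _ ht c' hc').1 ha]
        · rw [(hd _ _ _ ht c hc).2 ha, (hd _ _ _ ht c' hc').2 ha]
      · exact ((hd _ _ _ ht c' hc').2 ha).symm
    | refl _ => rfl
    | symm _ _ _ ih => exact ih.symm
    | trans _ _ _ _ _ ih₁ ih₂ => exact ih₁.trans ih₂
  refine ⟨Quotient.lift d hinv, ?_⟩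
  rintro ⟨k, a, κ⟩ ht k' hk'
  obtain ⟨c, μ, hc, ha, rfl, rfl⟩ := mem_proj_trans.1 ht
  obtain ⟨c', hc', rfl⟩ := mem_supp_map.1 hk'
  change d c < d c'
  rw [(hd _ _ _ hc c' hc').1 ha]
  exact Nat.lt_succ_self _

/-- The projection onto the second component is matched by that component. -/
theorem IsExecutionMapping.matches_projMap {M : C.State → L₁.State × A.State}
    (hM : C.IsExecutionMapping (L₁.comp A) M) :
    Matches (C.proj A.alphabet fun c => (M c).2) A
      (C.projMap A.alphabet fun c => (M c).2) := by
  intro k a κ hk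
  obtain ⟨c, μ, hc, ha, rfl, rfl⟩ := mem_proj_trans.1 hk
  obtain ⟨ν, hν, hbelow⟩ := hM.below hc
  obtain ⟨ν₁, ν₂, rfl, ⟨-, h₂, -⟩ | ⟨ha', -, -⟩⟩ := comp_trans_cases hν
  · refine ⟨ν₂, h₂, ((below_map _ μ).flip.trans (hbelow.trans
      (map_snd_prod ν₁ ν₂ ▸ below_map Prod.snd (ν₁.prod ν₂)))).mono ?_⟩
    rintro k' - x - ⟨c', -, rfl, p, -, rfl, rfl⟩
    rfl
  · exact absurd ha ha'

/-- A simulation of the projection by `B` yields a simulation of `C` by the composition. -/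
theorem IsExecutionMapping.sim_comp {B : LPTS.{u, v} Act} (hB : B.alphabet = A.alphabet)
    {M : C.State → L₁.State × A.State} (hM : C.IsExecutionMapping (L₁.comp A) M)
    (h : (C.proj A.alphabet fun c => (M c).2).Sim B) : C.Sim (L₁.comp B) := by
  obtain ⟨R, hR, hstart⟩ := h
  refine ⟨fun c p => (M c).1 = p.1 ∧
    R (Quotient.mk (C.projSetoid A.alphabet fun c => (M c).2) c) p.2, ?_,
    congrArg Prod.fst hM.map_start, hstart⟩
  rintro c ⟨s₁, s₂⟩ ⟨rfl, hc₂⟩ a μ hc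
  obtain ⟨ν, hν, hbelow⟩ := hM.below hc
  obtain ⟨ν₁, ν₂, rfl, ⟨ha, h₂, hex⟩ | ⟨ha, rfl, hex⟩⟩ := comp_trans_cases hν
  · obtain ⟨ρ, hρ, hκρ⟩ := hR _ _ hc₂ a _ (mem_proj_trans.2 ⟨c, μ, hc, ha, rfl, rfl⟩)
    -- The target is the product of `ν₁` and `ρ`, so `ν₂` must be coupled with `ρ` on its own. This
    -- goes back from `ν₂` to any successor `c''` with the same second component and on through its
    -- merged class. Merging such siblings is what identifies `c''` with `c'`.
    refine ⟨_, hex B s₂ ρ hρ, (hbelow.trans ((below_refl ν₁).prod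
      (((map_snd_prod ν₁ ν₂ ▸ below_map Prod.snd (ν₁.prod ν₂)).flip.trans hbelow.flip).trans
        ((below_map _ μ).trans hκρ)))).mono ?_⟩
    rintro c' hc' ⟨r₁, r₂⟩ - ⟨p, -, rfl, h₁, c'', hc'', ⟨p', -, hp', rfl⟩, k, -, rfl, hk⟩
    refine ⟨h₁, ?_⟩
    rwa [show Quotient.mk (C.projSetoid A.alphabet fun c => (M c).2) c' = Quotient.mk _ c'' from
      Quotient.sound (Relation.EqvGen.rel _ _ ⟨hp'.symm, _, hc, hc'', Or.inl hc'⟩)]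
  -- The second component rests at `s₂`, and `c` is merged with its successors, so `R` carries over.
  · refine ⟨_, hex B (hB ▸ ha) s₂, (hbelow.trans ((below_refl ν₁).prod
      (below_dirac (R := fun x s => x = (M c).2 ∧ s = s₂) ⟨rfl, rfl⟩))).mono ?_⟩
    rintro c' hc' ⟨r₁, r₂⟩ - ⟨p, -, rfl, h₁, h₂, rfl⟩
    refine ⟨h₁, ?_⟩
    rwa [← show Quotient.mk (C.projSetoid A.alphabet fun c => (M c).2) c = Quotient.mk _ c' from
      Quotient.sound (Relation.EqvGen.rel _ _ ⟨h₂.symm, _, hc, hc', Or.inr ⟨ha, rfl⟩⟩)]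

end Projection

end LPTS

namespace LPTS

variable {Act : Type u}

open ProbDist

/-! ### Finite unfoldings and the existence of tree counterexamples -/

section Unfolding

variable (L : LPTS.{u, v} Act)

/-- The `n`-th approximant of the greatest strong simulation. -/
def SimUpTo (L P : LPTS.{u, v} Act) : ℕ → L.State → P.State → Prop
  | 0 => fun _ _ => True
  | n + 1 => fun s p => ∀ a μ, (s, a, μ) ∈ L.trans →
      ∃ ν, (p, a, ν) ∈ P.trans ∧ Below (SimUpTo L P n) μ ν

theorem simUpTo_succ_le {P : LPTS.{u, v} Act} (n : ℕ) :
    ∀ s p, SimUpTo L P (n + 1) s p → SimUpTo L P n s p := by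
  induction n with
  | zero => exact fun _ _ _ => trivial
  | succ n ih =>
    intro s p h a μ hμ
    obtain ⟨ν, hν, hb⟩ := h a μ hμ
    exact ⟨ν, hν, hb.mono fun _ _ _ _ => ih _ _⟩

/-- The approximants are a decreasing chain of subsets of a finite set, and a stationary one is a
strong simulation. -/
theorem exists_not_simUpTo {P : LPTS.{u, v} Act} (h : ¬ L.Sim P) :
    ∃ n, ¬ SimUpTo L P n L.start P.start := by
  let A : ℕ →o (Set (L.State × P.State))ᵒᵈ :=
    ⟨fun n => OrderDual.toDual {x | SimUpTo L P n x.1 x.2},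
      monotone_nat_of_le_succ fun n x hx => simUpTo_succ_le L n x.1 x.2 hx⟩
  obtain ⟨n, hn⟩ := WellFoundedGT.monotone_chain_condition A
  refine ⟨n, fun hs => h ⟨SimUpTo L P n, fun s p hsp => ?_, hs⟩⟩
  have heq : {x : L.State × P.State | SimUpTo L P n x.1 x.2} =
      {x | SimUpTo L P (n + 1) x.1 x.2} := hn (n + 1) n.le_succ
  exact (Set.ext_iff.1 heq (s, p)).1 hsp

variable {ι : Type v} (e : ι → L.State × Act × ProbDist L.State)

/-- The last state of a path; a path is a list of transitions, each with the successor chosen,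
the most recent one first. -/
def tip : List (ι × L.State) → L.State
  | [] => L.start
  | x :: _ => x.2

/-- The consecutive steps of a path fit together. -/
def IsPath : List (ι × L.State) → Prop
  | [] => True
  | x :: l => (e x.1).1 = L.tip l ∧ x.2 ∈ (e x.1).2.2.supp ∧ IsPath l

/-- The paths with at most `N` steps. -/
abbrev Path (N : ℕ) : Type v := {l : List (ι × L.State) // L.IsPath e l ∧ l.length ≤ N}

open Classical in
/-- The extension of a path by one step, or the path itself if that step is not possible. -/
noncomputable def extend {N : ℕ} (l : L.Path e N) (i : ι) (s : L.State) : L.Path e N :=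
  if h : L.IsPath e ((i, s) :: l.1) ∧ ((i, s) :: l.1).length ≤ N then ⟨(i, s) :: l.1, h⟩ else l

variable {L e} in
theorem extend_val {N : ℕ} {l : L.Path e N} {i : ι} {s : L.State} (hi : (e i).1 = L.tip l.1)
    (hl : l.1.length < N) (hs : s ∈ (e i).2.2.supp) : (L.extend e l i s).1 = (i, s) :: l.1 := by
  rw [extend, dif_pos ⟨⟨hi, hs, l.2.1⟩, hl⟩]

instance [Finite ι] (N : ℕ) : Finite (L.Path e N) :=
  ((List.finite_length_le (ι × L.State) N).subset fun _ h => h.2).to_subtype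

/-- The unfolding of `L` up to depth `N`. -/
noncomputable def unfold [Finite ι] (hmem : ∀ i, e i ∈ L.trans) (N : ℕ) : LPTS.{u, v} Act where
  State := L.Path e N
  fintypeState := Fintype.ofFinite _
  start := ⟨[], trivial, Nat.zero_le _⟩
  alphabet := L.alphabet
  alphabet_finite := L.alphabet_finite
  trans :=
    letI : Fintype (L.Path e N) := Fintype.ofFinite _
    {t | ∃ (l : L.Path e N) (i : ι), (e i).1 = L.tip l.1 ∧ l.1.length < N ∧
      t = (l, (e i).2.1, map (L.extend e l i) (e i).2.2)}
  trans_finite := by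
    let : Fintype (L.Path e N) := Fintype.ofFinite _
    refine (Set.finite_range fun x : L.Path e N × ι =>
      (x.1, (e x.2).2.1, map (L.extend e x.1 x.2) (e x.2).2.2)).subset ?_
    rintro t ⟨l, i, -, -, rfl⟩
    exact ⟨(l, i), rfl⟩
  label_mem := by
    rintro t ⟨l, i, -, -, rfl⟩
    exact L.label_mem _ (hmem i)

variable {L e} [Finite ι] {hmem : ∀ i, e i ∈ L.trans} {N : ℕ}

theorem mem_unfold_trans {l : (L.unfold e hmem N).State} {a : Act}
    {κ : ProbDist (L.unfold e hmem N).State} :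
    (l, a, κ) ∈ (L.unfold e hmem N).trans ↔ ∃ i, (e i).1 = L.tip l.1 ∧ l.1.length < N ∧
      (e i).2.1 = a ∧ map (T := (L.unfold e hmem N).State) (L.extend e l i) (e i).2.2 = κ := by
  constructor
  · rintro ⟨l, i, hi, hl, he⟩
    cases he
    exact ⟨i, hi, hl, rfl, rfl⟩
  · rintro ⟨i, hi, hl, rfl, rfl⟩
    exact ⟨l, i, hi, hl, rfl⟩

theorem mem_supp_unfold {l l' : L.Path e N} {i : ι} (hi : (e i).1 = L.tip l.1)
    (hl : l.1.length < N) :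
    l' ∈ (map (T := (L.unfold e hmem N).State) (L.extend e l i) (e i).2.2).supp ↔
      ∃ s ∈ (e i).2.2.supp, l'.1 = (i, s) :: l.1 := by
  refine (mem_supp_map (T := (L.unfold e hmem N).State)).trans
    (exists_congr fun s => and_congr_right fun hs => ?_)
  rw [← extend_val hi hl hs]
  exact ⟨fun h => congrArg Subtype.val h.symm, fun h => Subtype.ext h.symm⟩

/-- A nonempty path records its prefix and the index of its last transition, so its only incoming
transition can be read off. -/
theorem unfold_isTree : (L.unfold e hmem N).IsTree where
  start_notMem := by
    rintro ⟨l, a, κ⟩ ht hmem'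
    obtain ⟨i, hi, hl, rfl, rfl⟩ := mem_unfold_trans.1 ht
    obtain ⟨s, -, hs⟩ := (mem_supp_unfold hi hl).1 hmem'
    exact List.cons_ne_nil _ _ hs.symm
  existsUnique := by
    rintro ⟨_ | ⟨⟨i, s⟩, l⟩, hpath, hlen⟩ hne
    · exact absurd rfl hne
    obtain ⟨hi, hs, hl⟩ := hpath
    refine ⟨((⟨l, hl, (Nat.le_succ _).trans hlen⟩ : L.Path e N), (e i).2.1, _),
      ⟨mem_unfold_trans.2 ⟨i, hi, hlen, rfl, rfl⟩,
        (mem_supp_unfold (l := ⟨l, hl, (Nat.le_succ _).trans hlen⟩) hi hlen).2 ⟨s, hs, rfl⟩⟩, ?_⟩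
    rintro ⟨l', a, κ⟩ ⟨ht, hmem'⟩
    obtain ⟨j, hj, hl', rfl, rfl⟩ := mem_unfold_trans.1 ht
    obtain ⟨s', -, hs'⟩ := (mem_supp_unfold hj hl').1 hmem'
    obtain ⟨l', hl''⟩ := l'
    cases hs'
    rfl
  reachable := by
    rintro ⟨l, hpath, hlen⟩
    induction l with
    | nil => exact .refl
    | cons x l ih =>
      refine .tail (ih hpath.2.2 ((Nat.le_succ _).trans hlen))
        ⟨_, _, mem_unfold_trans.2 ⟨x.1, hpath.1, hlen, rfl, rfl⟩, ?_⟩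
      exact (mem_supp_unfold (l := ⟨l, hpath.2.2, (Nat.le_succ _).trans hlen⟩)
        hpath.1 hlen).2 ⟨x.2, hpath.2.1, rfl⟩

theorem unfold_isExecutionMapping :
    (L.unfold e hmem N).IsExecutionMapping L fun l => L.tip l.1 where
  map_start := rfl
  map_trans := by
    intro l a κ ht
    obtain ⟨i, hi, hl, rfl, rfl⟩ := mem_unfold_trans.1 ht
    have hinj : Set.InjOn (L.extend e l i) (e i).2.2.supp := by
      intro s hs s' hs' h
      have := congrArg Subtype.val h
      rw [extend_val hi hl hs, extend_val hi hl hs'] at this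
      cases this
      rfl
    refine ⟨(e i).2.2, hi ▸ hmem i, ?_, ?_⟩
    · intro l₁ h₁ l₂ h₂ h
      obtain ⟨s, -, hs⟩ := (mem_supp_unfold hi hl).1 h₁
      obtain ⟨s', -, hs'⟩ := (mem_supp_unfold hi hl).1 h₂
      refine Subtype.ext ?_
      change L.tip l₁.1 = L.tip l₂.1 at h
      rw [hs, hs'] at h ⊢
      change s = s' at h
      rw [h]
    · intro l' hl'
      obtain ⟨s, hs, rfl⟩ := mem_supp_map.1 hl'
      rw [extend_val hi hl hs]
      exact map_prob_of_injOn (T := (L.unfold e hmem N).State) hinj hs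

/-- A path of length `k` can still be extended by `N - k` steps, so whatever simulates it simulates
its last state up to that depth. -/
theorem simUpTo_of_unfold_sim {P : LPTS.{u, v} Act} (hsurj : ∀ t ∈ L.trans, ∃ i, e i = t)
    (h : (L.unfold e hmem N).Sim P) : SimUpTo L P N L.start P.start := by
  obtain ⟨R, hR, hstart⟩ := h
  suffices ∀ (n : ℕ) (l : L.Path e N) (p : P.State), R l p → l.1.length + n ≤ N →
      SimUpTo L P n (L.tip l.1) p from
    this N _ _ hstart (Nat.zero_add N).le
  intro n
  induction n with
  | zero => exact fun _ _ _ _ => trivial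
  | succ n ih =>
    intro l p hlp hlen a μ hμ
    obtain ⟨i, hi⟩ := hsurj _ hμ
    have hi1 : (e i).1 = L.tip l.1 := by rw [hi]
    have hl : l.1.length < N := by omega
    obtain ⟨ν, hν, hb⟩ := hR l p hlp _ _ (mem_unfold_trans.2 ⟨i, hi1, hl, rfl, rfl⟩)
    have hext : ∀ s ∈ (e i).2.2.supp, (L.extend e l i s).1 = (i, s) :: l.1 :=
      fun s hs => extend_val hi1 hl hs
    have hb' := (below_map (T := (L.unfold e hmem N).State) (L.extend e l i) (e i).2.2).trans hb
    rw [hi] at hν hb' hext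
    refine ⟨ν, hν, hb'.mono ?_⟩
    rintro s hs p' - ⟨l', -, rfl, hp'⟩
    have := ih _ p' hp' (by rw [hext s hs, List.length_cons]; omega)
    rwa [hext s hs] at this

/-- If `L` is not simulated by `P`, then some tree that unfolds `L` is not either. -/
theorem exists_tree_of_not_sim {L P : LPTS.{u, v} Act} (h : ¬ L.Sim P) :
    ∃ (C : LPTS.{u, v} Act) (M : C.State → L.State), C.IsTree ∧ C.IsExecutionMapping L M ∧
      ¬ C.Sim P := by
  obtain ⟨N, hN⟩ := exists_not_simUpTo L h
  have := L.trans_finite.to_subtype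
  obtain ⟨n, ⟨φ⟩⟩ := Finite.exists_equiv_fin L.trans
  -- Paths use indices of transitions because labels live in `Type u`, whereas the states of the
  -- unfolding must lie in `Type v`.
  let e : ULift.{v} (Fin n) → L.State × Act × ProbDist L.State := fun i => (φ.symm i.down).1
  have hmem : ∀ i, e i ∈ L.trans := fun i => (φ.symm i.down).2
  exact ⟨L.unfold e hmem N, _, unfold_isTree, unfold_isExecutionMapping, fun hs =>
    hN (simUpTo_of_unfold_sim (fun t ht => ⟨⟨φ ⟨t, ht⟩⟩, by simp [e]⟩) hs)⟩

end Unfolding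

end LPTS

/-! ### Runs of the algorithm -/

namespace AGAR

open LPTS

variable {Act : Type u} {L₁ L₂ P : LPTS.{u, v} Act}

theorem Refines.lt {q q' : Setoid L₂.State} (h : Refines L₁ L₂ P q q') : q' < q := by
  obtain ⟨-, C, M, hC, l, hl, hs⟩ := h
  exact analyzeAndRefine_lt (D := projAssumption C M) (L := L₂)
    (IsExecutionMapping.matches_projMap (A := L₂.quot q) hC.isExecutionMapping) hl hs

/-- The finer quotient maps onto the coarser one; equal cardinalities would make this map injective
and the partitions equal. -/
theorem card_quotient_lt {S : Type*} [Finite S] {q q' : Setoid S} (h : q' < q) :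
    Nat.card (Quotient q) < Nat.card (Quotient q') := by
  let f : Quotient q' → Quotient q := Quotient.map id fun _ _ hs => h.le hs
  have hf : Function.Surjective f := by
    rintro ⟨s⟩
    exact ⟨Quotient.mk q' s, rfl⟩
  refine lt_of_le_of_ne (Nat.card_le_card_of_surjective f hf) fun heq => h.not_ge ?_
  have hinj := (hf.bijective_of_nat_card_le heq.ge).1
  exact fun s s' hs => Quotient.exact (hinj (Quotient.sound hs :
    f (Quotient.mk q' s) = f (Quotient.mk q' s')))

/-- The start state gives the coarsest partition a class, and each refinement adds at least one. The
strict inequality is the source of the `- 1` in the bound. -/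
theorem Reaches.lt_card {n : ℕ} {q : Setoid L₂.State} (h : Reaches L₁ L₂ P n q) :
    n < Nat.card (Quotient q) := by
  induction h with
  | init =>
    have : Nonempty (Quotient (⊤ : Setoid L₂.State)) := ⟨Quotient.mk _ L₂.start⟩
    exact Nat.card_pos
  | step _ hr ih => exact lt_of_le_of_lt ih (card_quotient_lt hr.lt)

theorem Reaches.le_card {n : ℕ} {q : Setoid L₂.State} (h : Reaches L₁ L₂ P n q) :
    n ≤ Nat.card L₂.State - 1 :=
  Nat.le_sub_one_of_lt (h.lt_card.trans_le
    (Nat.card_le_card_of_surjective (Quotient.mk q) Quotient.exists_rep))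

theorem exists_obtained {q : Setoid L₂.State} (h : ¬ (L₁.comp (L₂.quot q)).Conforms P) :
    ∃ (C : LPTS.{u, v} Act) (M : C.State → L₁.State × Quotient q), Obtained L₁ L₂ P q C M := by
  obtain ⟨C, M, hC, hM, hP⟩ := exists_tree_of_not_sim h
  exact ⟨C, M, hC, hM, hM.sim, hP⟩

theorem Obtained.exists_order {q : Setoid L₂.State} {C : LPTS.{u, v} Act}
    {M : C.State → L₁.State × Quotient q} (h : Obtained L₁ L₂ P q C M) :
    ∃ l, (projAssumption C M).IsBottomUpOrder l := by
  obtain ⟨d, hd⟩ := h.isTree.exists_proj_depth (L₂.quot q).alphabet fun c => (M c).2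
  exact exists_isBottomUpOrder d hd

/-- A counterexample that is not found to be spurious is real. -/
theorem Obtained.isCounterexample_of_none {q : Setoid L₂.State} {C : LPTS.{u, v} Act}
    {M : C.State → L₁.State × Quotient q} (h : Obtained L₁ L₂ P q C M)
    {l : List ((projAssumption C M).State × Act × ProbDist (projAssumption C M).State)}
    (hl : (projAssumption C M).IsBottomUpOrder l)
    (hn : analyzeAndRefine q (projAssumptionMap C M) l = none) :
    C.IsCounterexample (L₁.comp L₂) P := by
  obtain ⟨d, hd⟩ := h.isTree.exists_proj_depth (L₂.quot q).alphabet fun c => (M c).2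
  obtain ⟨R, hR, hstart⟩ := analyzeAndRefine_none hl
    (fun t ht hmem => lt_irrefl _ (hd t ht _ hmem))
    (congrArg Prod.snd h.isExecutionMapping.map_start) hn
  exact ⟨IsExecutionMapping.sim_comp (A := L₂.quot q) rfl h.isExecutionMapping ⟨R, hR, hstart⟩,
    h.isCounterexample.2⟩

end AGAR

theorem mainTheorem2 {Act : Type u} (L₁ L₂ P : LPTS.{u, v} Act) :
    -- every run makes at most `|S₂| - 1` refinements
    (∀ n q, AGAR.Reaches L₁ L₂ P n q → n ≤ Nat.card L₂.State - 1) ∧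
    (¬ ∃ q : ℕ → Setoid L₂.State, q 0 = ⊤ ∧ ∀ i, AGAR.Refines L₁ L₂ P (q i) (q (i + 1))) ∧
    -- no run gets stuck: when the premise fails, a tree counterexample can be obtained, and
    -- whichever one is obtained, the analysis of its projection can be carried out
    (∀ n q, AGAR.Reaches L₁ L₂ P n q → ¬ (L₁.comp (L₂.quot q)).Conforms P →
      (∃ (C : LPTS.{u, v} Act) (M : C.State → L₁.State × Quotient q),
        AGAR.Obtained L₁ L₂ P q C M) ∧
      ∀ (C : LPTS.{u, v} Act) (M : C.State → L₁.State × Quotient q),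
        AGAR.Obtained L₁ L₂ P q C M → ∃ l, (AGAR.projAssumption C M).IsBottomUpOrder l) ∧
    -- whatever a run returns is correct
    (∀ n q o, AGAR.Reaches L₁ L₂ P n q → AGAR.Returns L₁ L₂ P q o →
      (¬ (L₁.comp L₂).Conforms P ↔
        ∃ C, o = AGAR.Outcome.counterexample C ∧ C.IsCounterexample (L₁.comp L₂) P) ∧
      ((L₁.comp L₂).Conforms P ↔ o = AGAR.Outcome.holds)) := by
  refine ⟨fun n q h => h.le_card, ?_, fun n q _ h =>
    ⟨AGAR.exists_obtained h, fun C M hC => hC.exists_order⟩, ?_⟩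
  · rintro ⟨q, h0, hq⟩
    have hreach : ∀ n, AGAR.Reaches L₁ L₂ P n (q n) := by
      intro n
      induction n with
      | zero => exact h0 ▸ .init
      | succ n ih => exact .step ih (hq n)
    -- An infinite run would make `|S₂|` refinements. With truncated subtraction this contradicts
    -- the bound only because `|S₂|` is positive.
    have := (hreach (Nat.card L₂.State)).le_card
    have : Nonempty L₂.State := ⟨L₂.start⟩
    have : 0 < Nat.card L₂.State := Nat.card_pos
    omega
  · rintro n q o - (hconf | ⟨-, C, M, hC, l, hl, hn⟩)
    · have := LPTS.Conforms.of_quot hconf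
      simp [this]
    · have hreal := hC.isCounterexample_of_none hl hn
      have hnot : ¬ (L₁.comp L₂).Conforms P := fun h => hreal.2 (hreal.1.trans h)
      exact ⟨⟨fun _ => ⟨C, rfl, hreal⟩, fun _ => hnot⟩,
        ⟨fun h => absurd h hnot, fun h => by cases h⟩⟩
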